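/- **Proposition 4.2 ($q$-integral representation).** Let $0<q<1$, let $-\infty\le a,b\le\infty$, and write $\int_I f\,d_qx=\int_0^b f\,d_qx-\int_0^a f\,d_qx$ for the Jackson integral over $I=[a,b]$, where $$\int_0^{e} f\,d_qx=(1-q)\sum_{s\ge 0}e q^sf(eq^s)\quad(e\in\mathbb R),\qquad \int_0^{\pm\infty} f\,d_qx=\pm(1-q)\sum_{s\in\mathbb Z}q^sf(\pm q^s);$$ $\int_{I^n}$ denotes the $n$-fold iterated Jackson integral. Let $\omega:\mathbb R\to\mathbb R$ be a weight such that for every $k\ge0$ the series defining $\int_0^a x^k\omega(x)\,d_qx$ and $\int_0^b x^k\omega(x)\,d_qx$ converge absolutely. Put $$\Delta_q^4(x)=\prod_{1\le j<k\le n}(x_j-x_k)^2(x_j-qx_k)(x_j-q^{-1}x_k),\qquad \tau_{2n}=\frac1{n!}\int_{I^n}\Delta_q^4(x)\prod_{i=1}^n\omega(x_i)\,d_qx_i,$$ and assume $\tau_{2n}\ne0$ for all $n\ge0$. Let $D_qf(x)=\frac{f(x)-f(qx)}{(1-q)x}$ and $$\langle f,g\rangle=\int_I\bigl(f(x)D_qg(x)-g(x)D_qf(x)\bigr)\omega(x)\,d_qx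 .$$ Call a sequence of real monic polynomials $Q_0,Q_1,\dots$ with $\deg Q_n=n$ *$q$-skew orthogonal* if there are real numbers $u_n$ with $\langle Q_{2n},Q_{2m+1}\rangle=-\langle Q_{2m+1},Q_{2n}\rangle=u_n\delta_{n,m}$ and $\langle Q_{2m},Q_{2n}\rangle=\langle Q_{2m+1},Q_{2n+1}\rangle=0$ for all $m,n\ge0$. Then: 1. For all $n\ge 0$, $\ \mathrm{Pf}\bigl[\langle x^i,x^j\rangle\bigr]_{i,j=0}^{2n-1}=q^{n(n-1)}\,\tau_{2n}$. 2. A sequence of real polynomials $(Q_n)_{n\ge0}$ is a monic $q$-skew orthogonal sequence if and only if for all $n\ge0$ $$Q_{2n}(x)=\frac{1}{n!\,\tau_{2n}}\int_{I^n}\Delta_q^4(y)\prod_{i=1}^n(x-y_i)(x-qy_i)\,\omega(y_i)\,d_qy_i$$ and there are real constants $c_n$ with, for all $n\ge0$, $$Q_{2n+1}(x)=\frac{1}{n!\,\tau_{2n}}\int_{I^n}\Delta_q^4(y)\Bigl(x+(1+q)\sum_{i=1}^ny_i+c_n\Bigr)\prod_{i=1}^n(x-y_i)(x-qy_i)\,\omega(y_i)\,d_qy_i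 .$$ In particular, the constants $c_n$ may be chosen arbitrarily. -/

import Mathlib

open Polynomial

/-- The `q`-difference operator `D_q f(x) = (f(x) - f(qx)) / ((1-q)x)`. -/
noncomputable def qDiff (q : ℝ) (f : ℝ → ℝ) (x : ℝ) : ℝ :=
  (f x - f (q * x)) / ((1 - q) * x)

/-- The Jackson `q`-integral `∫_0^e f(x) d_q x` for an endpoint `e ∈ [-∞, ∞]`. -/
noncomputable def jacksonFromZero (q : ℝ) (f : ℝ → ℝ) : EReal → ℝ
  | ⊥ => -((1 - q) * ∑' s : ℤ, q ^ s * f (-q ^ s))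
  | ⊤ => (1 - q) * ∑' s : ℤ, q ^ s * f (q ^ s)
  | (a : ℝ) => (1 - q) * ∑' s : ℕ, a * q ^ s * f (a * q ^ s)

/-- Absolute convergence of the series that defines `∫_0^e f(x) d_q x`. -/
def JacksonSummable (q : ℝ) (f : ℝ → ℝ) : EReal → Prop
  | ⊥ => Summable fun s : ℤ => q ^ s * f (-q ^ s)
  | ⊤ => Summable fun s : ℤ => q ^ s * f (q ^ s)
  | (a : ℝ) => Summable fun s : ℕ => a * q ^ s * f (a * q ^ s)

/-- The Jackson `q`-integral `∫_a^b f(x) d_q x = ∫_0^b f(x) d_q x - ∫_0^a f(x) d_q x`. -/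
noncomputable def jacksonIntegral (q : ℝ) (a b : EReal) (f : ℝ → ℝ) : ℝ :=
  jacksonFromZero q f b - jacksonFromZero q f a

/-- The `n`-fold Jackson integral `∫_{I^n} F(x_1, …, x_n) d_q x_1 ⋯ d_q x_n` over `I = [a, b]`. -/
noncomputable def jacksonIntegralPi (q : ℝ) (a b : EReal) :
    (n : ℕ) → ((Fin n → ℝ) → ℝ) → ℝ
  | 0, F => F ![]
  | n + 1, F => jacksonIntegral q a b fun y =>
      jacksonIntegralPi q a b n fun v => F (Fin.cons y v)

/-- All moments of the weight `ω` on `I = [a, b]` converge absolutely. -/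
def HasJacksonMoments (q : ℝ) (a b : EReal) (ω : ℝ → ℝ) : Prop :=
  ∀ k : ℕ, JacksonSummable q (fun x => x ^ k * ω x) a ∧
    JacksonSummable q (fun x => x ^ k * ω x) b

/-- The product `∏_{j<k} (x_j - x_k)² (x_j - q x_k) (x_j - q⁻¹ x_k)`. -/
noncomputable def qDelta4 (q : ℝ) {n : ℕ} (x : Fin n → ℝ) : ℝ :=
  ∏ j : Fin n, ∏ k ∈ Finset.Ioi j,
    ((x j - x k) ^ 2 * (x j - q * x k) * (x j - q⁻¹ * x k))

/-- The partition function `τ_{2n}` of the `n`-particle `q`-symplectic ensemble. -/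
noncomputable def qTau (q : ℝ) (a b : EReal) (ω : ℝ → ℝ) (n : ℕ) : ℝ :=
  1 / (n.factorial : ℝ) *
    jacksonIntegralPi q a b n fun x => qDelta4 q x * ∏ i, ω (x i)

/-- The skew inner product `⟨f, g⟩ = ∫_I (f D_q g - g D_q f) ω d_q x`. -/
noncomputable def qSkewInner (q : ℝ) (a b : EReal) (ω : ℝ → ℝ) (f g : ℝ[X]) : ℝ :=
  jacksonIntegral q a b fun x =>
    (f.eval x * qDiff q (fun y => g.eval y) x
      - g.eval x * qDiff q (fun y => f.eval y) x) * ω x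

/-- `Q_0, Q_1, …` is a system of monic `q`-skew orthogonal polynomials, `deg Q_n = n`. -/
def IsQSkewOrthogonal (q : ℝ) (a b : EReal) (ω : ℝ → ℝ) (Q : ℕ → ℝ[X]) : Prop :=
  (∀ n, (Q n).Monic ∧ (Q n).natDegree = n) ∧
  ∃ u : ℕ → ℝ, ∀ m n : ℕ,
    qSkewInner q a b ω (Q (2 * n)) (Q (2 * m + 1)) = (if n = m then u n else 0) ∧
    qSkewInner q a b ω (Q (2 * m + 1)) (Q (2 * n)) = -(if n = m then u n else 0) ∧
    qSkewInner q a b ω (Q (2 * m)) (Q (2 * n)) = 0 ∧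
    qSkewInner q a b ω (Q (2 * m + 1)) (Q (2 * n + 1)) = 0

/-- The Pfaffian of a `2n × 2n` skew-symmetric matrix,
`(2^n n!)⁻¹ ∑_σ sgn(σ) ∏_{i<n} A_{σ(2i), σ(2i+1)}`. -/
noncomputable def pfaffian {n : ℕ} (A : Matrix (Fin (2 * n)) (Fin (2 * n)) ℝ) : ℝ :=
  1 / (2 ^ n * (n.factorial : ℝ)) *
    ∑ σ : Equiv.Perm (Fin (2 * n)), ((Equiv.Perm.sign σ : ℤ) : ℝ) *
      ∏ i : Fin n, A (σ ⟨2 * i, by omega⟩) (σ ⟨2 * i + 1, by omega⟩)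

/-- The leading `2n × 2n` block of the moment matrix `m_{i,j} = ⟨x^i, x^j⟩`. -/
noncomputable def qMomentMatrix (q : ℝ) (a b : EReal) (ω : ℝ → ℝ) (n : ℕ) :
    Matrix (Fin (2 * n)) (Fin (2 * n)) ℝ :=
  Matrix.of fun i j => qSkewInner q a b ω (X ^ (i : ℕ)) (X ^ (j : ℕ))

/-!
The skew inner product integrates `f (q x) g x - f x g (q x)` against `ω x / ((1 - q) x)`, so by
de Bruijn's formula the Pfaffian of `⟨f i, f j⟩` is, up to `n!`, the `n`-fold integral of the
determinant of the `f j` at the nodes `q y₁, y₁, …, q yₙ, yₙ`. For monomials this is the Vandermonde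
determinant of the nodes, which is `q ^ (n (n - 1)) Δ_q⁴(y)` up to factors cancelling the weight.

Let `p` be orthogonal to all polynomials of degree `< 2 n`, and let the polynomials `G y` vanish at
the nodes of `y` and differ from `p` in degree `< 2 n`. Interpolation at the nodes writes
`(p - G y) x` times the Vandermonde determinant as a combination of determinants with one monomial
replaced by `p`; the integrals of these are Pfaffians with a zero row and column. Hence `p x` is the
average of `G y x` over `y` with density `Δ_q⁴ ∏ ω`. With `G = 0` this shows that the skew form is
nondegenerate in degree `< 2 n`, so a `p` with prescribed leading terms exists; with
`G y x = ∏ (x - y i) (x - q y i)`, possibly times a monic linear factor, it gives the integral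
formulas.
-/

section JacksonIntegral

variable {q : ℝ} {a b : EReal}

/-- Integrability on `I = [a, b]` for the Jackson integral: absolute convergence of both series. -/
def JacksonIntegrable (q : ℝ) (a b : EReal) (f : ℝ → ℝ) : Prop :=
  JacksonSummable q f a ∧ JacksonSummable q f b

-- The three kinds of endpoint differ only in the index set and the nodes: the weight of a node is
-- always the node itself, so the value of the integrand at `0` is immaterial.
theorem exists_jacksonFromZero_eq_tsum (q : ℝ) (e : EReal) :
    ∃ (S : Type) (x : S → ℝ), ∀ f : ℝ → ℝ,
      jacksonFromZero q f e = (1 - q) * ∑' s, x s * f (x s) ∧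
        (JacksonSummable q f e ↔ Summable fun s => x s * f (x s)) := by
  induction e with
  | bot =>
    refine ⟨ℤ, fun s => -q ^ s, fun f => ?_⟩
    simp only [neg_mul, tsum_neg, mul_neg, summable_neg_iff]
    exact ⟨rfl, Iff.rfl⟩
  | top => exact ⟨ℤ, fun s => q ^ s, fun f => ⟨rfl, Iff.rfl⟩⟩
  | coe c => exact ⟨ℕ, fun s => c * q ^ s, fun f => ⟨rfl, Iff.rfl⟩⟩

theorem JacksonSummable.add {f g : ℝ → ℝ} {e : EReal} (hf : JacksonSummable q f e)
    (hg : JacksonSummable q g e) : JacksonSummable q (fun x => f x + g x) e := by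
  obtain ⟨S, x, h⟩ := exists_jacksonFromZero_eq_tsum q e
  rw [(h _).2] at hf hg ⊢
  simpa only [mul_add] using hf.add hg

theorem JacksonSummable.const_mul {f : ℝ → ℝ} {e : EReal} (hf : JacksonSummable q f e) (c : ℝ) :
    JacksonSummable q (fun x => c * f x) e := by
  obtain ⟨S, x, h⟩ := exists_jacksonFromZero_eq_tsum q e
  rw [(h _).2] at hf ⊢
  simpa only [mul_left_comm] using hf.mul_left c

theorem jacksonSummable_congr_of_ne_zero {f g : ℝ → ℝ} (hfg : ∀ x, x ≠ 0 → f x = g x)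
    (e : EReal) : JacksonSummable q f e ↔ JacksonSummable q g e := by
  obtain ⟨S, x, h⟩ := exists_jacksonFromZero_eq_tsum q e
  rw [(h f).2, (h g).2]
  exact summable_congr fun s => mul_eq_mul_left_iff.2 <| or_iff_not_imp_right.2 (hfg _)

theorem jacksonFromZero_add {f g : ℝ → ℝ} {e : EReal} (hf : JacksonSummable q f e)
    (hg : JacksonSummable q g e) :
    jacksonFromZero q (fun x => f x + g x) e = jacksonFromZero q f e + jacksonFromZero q g e := by
  obtain ⟨S, x, h⟩ := exists_jacksonFromZero_eq_tsum q e
  rw [(h _).2] at hf hg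
  simp only [(h _).1, mul_add, hf.tsum_add hg]

theorem jacksonFromZero_const_mul (c : ℝ) (f : ℝ → ℝ) (e : EReal) :
    jacksonFromZero q (fun x => c * f x) e = c * jacksonFromZero q f e := by
  obtain ⟨S, x, h⟩ := exists_jacksonFromZero_eq_tsum q e
  simp only [(h _).1, mul_left_comm _ c, tsum_mul_left]

theorem jacksonFromZero_congr_of_ne_zero {f g : ℝ → ℝ} (hfg : ∀ x, x ≠ 0 → f x = g x)
    (e : EReal) : jacksonFromZero q f e = jacksonFromZero q g e := by
  obtain ⟨S, x, h⟩ := exists_jacksonFromZero_eq_tsum q e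
  rw [(h f).1, (h g).1]
  exact congrArg _ <| tsum_congr fun s =>
    mul_eq_mul_left_iff.2 <| or_iff_not_imp_right.2 (hfg _)

theorem JacksonIntegrable.add {f g : ℝ → ℝ} (hf : JacksonIntegrable q a b f)
    (hg : JacksonIntegrable q a b g) : JacksonIntegrable q a b fun x => f x + g x :=
  ⟨hf.1.add hg.1, hf.2.add hg.2⟩

theorem JacksonIntegrable.const_mul {f : ℝ → ℝ} (hf : JacksonIntegrable q a b f) (c : ℝ) :
    JacksonIntegrable q a b fun x => c * f x :=
  ⟨hf.1.const_mul c, hf.2.const_mul c⟩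

theorem jacksonIntegrable_congr_of_ne_zero {f g : ℝ → ℝ} (hfg : ∀ x, x ≠ 0 → f x = g x) :
    JacksonIntegrable q a b f ↔ JacksonIntegrable q a b g :=
  and_congr (jacksonSummable_congr_of_ne_zero hfg a) (jacksonSummable_congr_of_ne_zero hfg b)

theorem jacksonIntegral_add {f g : ℝ → ℝ} (hf : JacksonIntegrable q a b f)
    (hg : JacksonIntegrable q a b g) :
    jacksonIntegral q a b (fun x => f x + g x) =
      jacksonIntegral q a b f + jacksonIntegral q a b g := by
  rw [jacksonIntegral, jacksonFromZero_add hf.1 hg.1, jacksonFromZero_add hf.2 hg.2,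
    add_sub_add_comm]
  rfl

theorem jacksonIntegral_const_mul (c : ℝ) (f : ℝ → ℝ) :
    jacksonIntegral q a b (fun x => c * f x) = c * jacksonIntegral q a b f := by
  simp only [jacksonIntegral, jacksonFromZero_const_mul, mul_sub]

theorem jacksonIntegral_congr_of_ne_zero {f g : ℝ → ℝ} (hfg : ∀ x, x ≠ 0 → f x = g x) :
    jacksonIntegral q a b f = jacksonIntegral q a b g := by
  simp only [jacksonIntegral, jacksonFromZero_congr_of_ne_zero hfg]

/-- Integrability on `Iⁿ` for the iterated Jackson integral: the partial integrals over the last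
coordinates are integrable in the remaining one, at every stage. -/
def JacksonIntegrablePi (q : ℝ) (a b : EReal) : (n : ℕ) → ((Fin n → ℝ) → ℝ) → Prop
  | 0, _ => True
  | n + 1, F => (∀ y, JacksonIntegrablePi q a b n fun v => F (Fin.cons y v)) ∧
      JacksonIntegrable q a b fun y => jacksonIntegralPi q a b n fun v => F (Fin.cons y v)

theorem jacksonIntegralPi_const_mul {n : ℕ} (c : ℝ) (F : (Fin n → ℝ) → ℝ) :
    jacksonIntegralPi q a b n (fun y => c * F y) = c * jacksonIntegralPi q a b n F := by
  induction n with
  | zero => rfl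
  | succ n ih => simp only [jacksonIntegralPi, ih, jacksonIntegral_const_mul]

theorem jacksonIntegralPi_add {n : ℕ} {F G : (Fin n → ℝ) → ℝ} (hF : JacksonIntegrablePi q a b n F)
    (hG : JacksonIntegrablePi q a b n G) :
    jacksonIntegralPi q a b n (fun y => F y + G y) =
      jacksonIntegralPi q a b n F + jacksonIntegralPi q a b n G := by
  induction n with
  | zero => rfl
  | succ n ih =>
    simp only [jacksonIntegralPi, ih (hF.1 _) (hG.1 _), jacksonIntegral_add hF.2 hG.2]

theorem JacksonIntegrablePi.const_mul {n : ℕ} {F : (Fin n → ℝ) → ℝ}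
    (hF : JacksonIntegrablePi q a b n F) (c : ℝ) :
    JacksonIntegrablePi q a b n fun y => c * F y := by
  induction n with
  | zero => trivial
  | succ n ih =>
    refine ⟨fun y => ih (hF.1 y), ?_⟩
    simpa only [jacksonIntegralPi_const_mul] using hF.2.const_mul c

theorem JacksonIntegrablePi.add {n : ℕ} {F G : (Fin n → ℝ) → ℝ}
    (hF : JacksonIntegrablePi q a b n F) (hG : JacksonIntegrablePi q a b n G) :
    JacksonIntegrablePi q a b n fun y => F y + G y := by
  induction n with
  | zero => trivial
  | succ n ih =>
    refine ⟨fun y => ih (hF.1 y) (hG.1 y), ?_⟩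
    simpa only [jacksonIntegralPi_add (hF.1 _) (hG.1 _)] using hF.2.add hG.2

theorem jacksonIntegralPi_zero {n : ℕ} : jacksonIntegralPi q a b n (fun _ => 0) = 0 := by
  simpa only [zero_mul] using jacksonIntegralPi_const_mul (q := q) (a := a) (b := b) 0
    fun _ : Fin n → ℝ => 0

theorem jacksonIntegrablePi_zero {n : ℕ} : JacksonIntegrablePi q a b n fun _ => 0 := by
  induction n with
  | zero => trivial
  | succ n ih =>
    refine ⟨fun _ => ih, ?_⟩
    obtain ⟨S, x, h⟩ := exists_jacksonFromZero_eq_tsum q a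
    obtain ⟨S', x', h'⟩ := exists_jacksonFromZero_eq_tsum q b
    simp only [JacksonIntegrable, (h _).2, (h' _).2, jacksonIntegralPi_zero, mul_zero,
      summable_zero, and_self]

theorem JacksonIntegrablePi.sum {n : ℕ} {T : Type*} {s : Finset T} {F : T → (Fin n → ℝ) → ℝ}
    (hF : ∀ t ∈ s, JacksonIntegrablePi q a b n (F t)) :
    JacksonIntegrablePi q a b n fun y => ∑ t ∈ s, F t y := by
  simp only [← Finset.sum_apply]
  exact Finset.sum_induction F _ (fun _ _ => .add) jacksonIntegrablePi_zero hF

theorem jacksonIntegralPi_sum {n : ℕ} {T : Type*} {s : Finset T} {F : T → (Fin n → ℝ) → ℝ}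
    (hF : ∀ t ∈ s, JacksonIntegrablePi q a b n (F t)) :
    jacksonIntegralPi q a b n (fun y => ∑ t ∈ s, F t y) =
      ∑ t ∈ s, jacksonIntegralPi q a b n (F t) := by
  classical
  induction s using Finset.induction_on with
  | empty => exact jacksonIntegralPi_zero
  | insert t s ht ih =>
    rw [Finset.forall_mem_insert] at hF
    simp only [Finset.sum_insert ht, jacksonIntegralPi_add hF.1 (.sum hF.2), ih hF.2]

theorem jacksonIntegralPi_prod {n : ℕ} (f : Fin n → ℝ → ℝ) :
    jacksonIntegralPi q a b n (fun y => ∏ i, f i (y i)) = ∏ i, jacksonIntegral q a b (f i) := by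
  induction n with
  | zero => simp only [jacksonIntegralPi, Fin.prod_univ_zero]
  | succ n ih =>
    simp only [jacksonIntegralPi, Fin.prod_univ_succ, Fin.cons_zero, Fin.cons_succ,
      jacksonIntegralPi_const_mul, ih]
    simp only [mul_comm (f 0 _), jacksonIntegral_const_mul]
    exact mul_comm _ _

theorem jacksonIntegrablePi_prod {n : ℕ} {f : Fin n → ℝ → ℝ}
    (hf : ∀ i, JacksonIntegrable q a b (f i)) :
    JacksonIntegrablePi q a b n fun y => ∏ i, f i (y i) := by
  induction n with
  | zero => trivial
  | succ n ih =>
    simp only [JacksonIntegrablePi, Fin.prod_univ_succ, Fin.cons_zero, Fin.cons_succ,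
      jacksonIntegralPi_const_mul, jacksonIntegralPi_prod]
    refine ⟨fun y => (ih fun i => hf i.succ).const_mul _, ?_⟩
    simpa only [mul_comm] using (hf 0).const_mul (∏ i : Fin n, jacksonIntegral q a b (f i.succ))

theorem jacksonIntegralPi_congr_of_ne_zero {n : ℕ} {F G : (Fin n → ℝ) → ℝ}
    (hFG : ∀ y, (∀ i, y i ≠ 0) → F y = G y) :
    jacksonIntegralPi q a b n F = jacksonIntegralPi q a b n G := by
  induction n with
  | zero => exact hFG _ finZeroElim
  | succ n ih =>
    refine jacksonIntegral_congr_of_ne_zero fun y hy => ih fun v hv => hFG _ ?_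
    exact Fin.cases hy hv

end JacksonIntegral

section SkewForm

variable {q : ℝ} {a b : EReal} {ω : ℝ → ℝ}

/-- The `q`-Casorati determinant of two polynomials, the `q`-analogue of their Wronskian. -/
noncomputable def qCasoratian (q : ℝ) (f g : ℝ[X]) (x : ℝ) : ℝ :=
  f.eval (q * x) * g.eval x - f.eval x * g.eval (q * x)

/-- The weight against which the skew inner product integrates the `q`-Casorati determinant. -/
noncomputable def qSkewWeight (q : ℝ) (ω : ℝ → ℝ) (x : ℝ) : ℝ :=
  ω x / ((1 - q) * x)

theorem qSkewInner_eq_jacksonIntegral (q : ℝ) (a b : EReal) (ω : ℝ → ℝ) (f g : ℝ[X]) :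
    qSkewInner q a b ω f g =
      jacksonIntegral q a b fun x => qCasoratian q f g x * qSkewWeight q ω x := by
  unfold qSkewInner qDiff qCasoratian qSkewWeight
  congr 1
  ext x
  ring

theorem HasJacksonMoments.jacksonIntegrable_eval_mul (hω : HasJacksonMoments q a b ω) (p : ℝ[X]) :
    JacksonIntegrable q a b fun x => p.eval x * ω x := by
  induction p using Polynomial.induction_on' with
  | add p r hp hr => simpa only [eval_add, add_mul] using hp.add hr
  | monomial n c => simpa only [eval_monomial, mul_assoc] using
      JacksonIntegrable.const_mul (hω n) c

-- The determinant vanishes at `x = 0`, which compensates for the pole of the weight.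
theorem HasJacksonMoments.jacksonIntegrable_qCasoratian_mul (hω : HasJacksonMoments q a b ω)
    (f g : ℝ[X]) :
    JacksonIntegrable q a b fun x => qCasoratian q f g x * qSkewWeight q ω x := by
  obtain ⟨p, hp⟩ : X ∣ f.comp (C q * X) * g - f * g.comp (C q * X) := by
    simp [X_dvd_iff, coeff_zero_eq_eval_zero, eval_comp]
  refine (jacksonIntegrable_congr_of_ne_zero fun x hx => ?_).2 <|
    (hω.jacksonIntegrable_eval_mul p).const_mul (1 - q)⁻¹
  have hpx : qCasoratian q f g x = x * p.eval x := by
    simpa [qCasoratian, eval_comp] using congrArg (eval x) hp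
  rw [hpx, qSkewWeight]
  field_simp

theorem qSkewInner_self (q : ℝ) (a b : EReal) (ω : ℝ → ℝ) (f : ℝ[X]) :
    qSkewInner q a b ω f f = 0 := by
  simpa only [qSkewInner, sub_self, zero_mul] using
    jacksonIntegral_const_mul (q := q) (a := a) (b := b) 0 fun _ => 0

theorem qSkewInner_neg (q : ℝ) (a b : EReal) (ω : ℝ → ℝ) (f g : ℝ[X]) :
    -qSkewInner q a b ω f g = qSkewInner q a b ω g f := by
  rw [← neg_one_mul, qSkewInner, ← jacksonIntegral_const_mul]
  exact congrArg _ <| funext fun x => by ring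

theorem qSkewInner_smul_left (c : ℝ) (f g : ℝ[X]) :
    qSkewInner q a b ω (c • f) g = c * qSkewInner q a b ω f g := by
  simp only [qSkewInner_eq_jacksonIntegral, ← jacksonIntegral_const_mul, qCasoratian, eval_smul,
    smul_eq_mul]
  exact congrArg _ <| funext fun x => by ring

theorem HasJacksonMoments.qSkewInner_add_left (hω : HasJacksonMoments q a b ω) (f f' g : ℝ[X]) :
    qSkewInner q a b ω (f + f') g = qSkewInner q a b ω f g + qSkewInner q a b ω f' g := by
  simp only [qSkewInner_eq_jacksonIntegral]
  rw [← jacksonIntegral_add (hω.jacksonIntegrable_qCasoratian_mul f g)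
    (hω.jacksonIntegrable_qCasoratian_mul f' g)]
  simp only [qCasoratian, eval_add]
  exact congrArg _ <| funext fun x => by ring

/-- The skew inner product as a bilinear form on polynomials. -/
noncomputable def qSkewForm (hω : HasJacksonMoments q a b ω) : LinearMap.BilinForm ℝ ℝ[X] :=
  LinearMap.mk₂ ℝ (qSkewInner q a b ω) hω.qSkewInner_add_left qSkewInner_smul_left
    (fun f g g' => by
      simp only [← qSkewInner_neg q a b ω _ f, hω.qSkewInner_add_left, neg_add])
    (fun c f g => by
      simp only [← qSkewInner_neg q a b ω _ f, qSkewInner_smul_left, smul_eq_mul, mul_neg])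

theorem isAlt_qSkewForm (hω : HasJacksonMoments q a b ω) : (qSkewForm hω).IsAlt :=
  qSkewInner_self q a b ω

end SkewForm

theorem isCompl_orthogonal_of_disjoint {K V : Type*} [Field K] [AddCommGroup V]
    [Module K V] {B : LinearMap.BilinForm K V} (hB : B.IsRefl) {W : Submodule K V}
    [FiniteDimensional K W] (hW : Disjoint W (B.orthogonal W)) : IsCompl W (B.orthogonal W) := by
  refine ⟨hW, Submodule.codisjoint_iff_exists_add_eq.2 fun v => ?_⟩
  have hBW := B.nondegenerate_restrict_of_disjoint_orthogonal hB hW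
  set w := ((B.restrict W).toDual hBW).symm ((B v).domRestrict W)
  refine ⟨w, v - w, w.2, fun z hz => hB _ _ ?_, add_sub_cancel _ _⟩
  have hwz : B w z = B v z :=
    LinearMap.BilinForm.apply_toDual_symm_apply (hB := hBW) ((B v).domRestrict W) ⟨z, hz⟩
  rw [map_sub, LinearMap.sub_apply, hwz, sub_self]

section BlockDeterminant

open Equiv (Perm prodCongrRight prodCongrRight_apply)
open Equiv.Perm (sign)

variable {R κ ι : Type*} [CommRing R] [Fintype κ] [DecidableEq κ] [Fintype ι] [DecidableEq ι]

theorem sum_sign_mul_prod_det_submatrix (A : Matrix (κ × ι) (κ × ι) R) :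
    ∑ σ : Perm (κ × ι), (sign σ : R) *
        ∏ k, (A.submatrix (fun i => σ (k, i)) fun i => (k, i)).det =
      (Fintype.card ι).factorial ^ Fintype.card κ * A.det := by
  have expand_blocks (σ : Perm (κ × ι)) : (sign σ : R) *
      ∏ k, (A.submatrix (fun i => σ (k, i)) fun i => (k, i)).det =
        ∑ s : κ → Perm ι, (sign (σ * prodCongrRight s) : R) *
          ∏ p, A ((σ * prodCongrRight s) p) p := by
    simp only [Matrix.det_apply', Matrix.submatrix_apply, Finset.prod_univ_sum,
      Fintype.piFinset_univ, Finset.mul_sum, Finset.prod_mul_distrib, Fintype.prod_prod_type,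
      Perm.mul_apply, prodCongrRight_apply, Perm.sign_mul, Perm.sign_prodCongrRight, Units.val_mul,
      Units.coe_prod, Int.cast_mul, Int.cast_prod, mul_assoc]
  calc _ = ∑ s : κ → Perm ι, ∑ σ : Perm (κ × ι), (sign (σ * prodCongrRight s) : R) *
          ∏ p, A ((σ * prodCongrRight s) p) p := by
        rw [Finset.sum_comm]
        exact Finset.sum_congr rfl fun σ _ => expand_blocks σ
    _ = ∑ _s : κ → Perm ι, A.det := by
        refine Finset.sum_congr rfl fun _ _ => ?_
        rw [Matrix.det_apply']
        exact Equiv.sum_comp (Equiv.mulRight (prodCongrRight _))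
          fun σ : Perm (κ × ι) => (sign σ : R) * ∏ p, A (σ p) p
    _ = _ := by simp [Fintype.card_perm]

end BlockDeterminant

section Pairing

variable {n : ℕ}

/-- The enumeration of `Fin (2 * n)` by `n` pairs of neighbours, `(i, ε) ↦ 2 i + ε`. -/
def pairEquiv (n : ℕ) : Fin n × Fin 2 ≃ Fin (2 * n) :=
  finProdFinEquiv.trans (finCongr (mul_comm n 2))

theorem val_pairEquiv (p : Fin n × Fin 2) : (pairEquiv n p : ℕ) = p.2 + 2 * p.1 :=
  rfl

theorem pairEquiv_lt_pairEquiv {i j : Fin n} {ε δ : Fin 2} :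
    pairEquiv n (i, ε) < pairEquiv n (j, δ) ↔ i < j ∨ i = j ∧ ε < δ := by
  simp only [Fin.lt_def, Fin.ext_iff, val_pairEquiv]
  omega

theorem prod_prod_Ioi_pairEquiv {M : Type*} [CommMonoid M] (F : Fin (2 * n) → Fin (2 * n) → M) :
    ∏ k, ∏ l ∈ Finset.Ioi k, F k l =
      (∏ i, F (pairEquiv n (i, 0)) (pairEquiv n (i, 1))) *
        ∏ i, ∏ j ∈ Finset.Ioi i, ∏ ε, ∏ δ, F (pairEquiv n (i, ε)) (pairEquiv n (j, δ)) := by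
  have split_pairs (i j : Fin n) :
      (∏ ε, ∏ δ, if pairEquiv n (i, ε) < pairEquiv n (j, δ) then
        F (pairEquiv n (i, ε)) (pairEquiv n (j, δ)) else 1) =
      (if i = j then F (pairEquiv n (i, 0)) (pairEquiv n (j, 1)) else 1) *
        if i < j then ∏ ε, ∏ δ, F (pairEquiv n (i, ε)) (pairEquiv n (j, δ)) else 1 := by
    rcases lt_trichotomy i j with h | rfl | h
    · simp [pairEquiv_lt_pairEquiv, h, h.ne]
    · simp [pairEquiv_lt_pairEquiv]
    · simp [pairEquiv_lt_pairEquiv, h.not_gt, h.ne']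
  simp only [← Finset.filter_lt_eq_Ioi, Finset.prod_filter, ← (pairEquiv n).prod_comp,
    Fintype.prod_prod_type, ← Finset.prod_mul_distrib]
  refine Finset.prod_congr rfl fun i _ => ?_
  rw [Finset.prod_comm]
  simp only [split_pairs, Finset.prod_mul_distrib, Finset.prod_ite_eq, Finset.mem_univ, if_true]

theorem pfaffian_eq_sum_perm_pairs (A : Matrix (Fin (2 * n)) (Fin (2 * n)) ℝ) :
    pfaffian A = 1 / (2 ^ n * n.factorial) * ∑ σ : Equiv.Perm (Fin n × Fin 2),
      (Equiv.Perm.sign σ : ℝ) * ∏ i, A (pairEquiv n (σ (i, 0))) (pairEquiv n (σ (i, 1))) := by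
  have pair_zero (i : Fin n) : (pairEquiv n).symm ⟨2 * i, by omega⟩ = (i, 0) := by
    rw [Equiv.symm_apply_eq, Fin.ext_iff, val_pairEquiv]
    simp
  have pair_one (i : Fin n) : (pairEquiv n).symm ⟨2 * i + 1, by omega⟩ = (i, 1) := by
    rw [Equiv.symm_apply_eq, Fin.ext_iff, val_pairEquiv]
    simp [add_comm]
  rw [pfaffian, ← (pairEquiv n).permCongr.sum_comp]
  simp only [Equiv.Perm.sign_permCongr, Equiv.permCongr_apply, pair_zero, pair_one]

theorem pfaffian_eq_zero_of_row_col {A : Matrix (Fin (2 * n)) (Fin (2 * n)) ℝ} {r : Fin (2 * n)}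
    (hrow : ∀ k, A r k = 0) (hcol : ∀ k, A k r = 0) : pfaffian A = 0 := by
  rw [pfaffian_eq_sum_perm_pairs]
  refine mul_eq_zero_of_right _ <| Finset.sum_eq_zero fun σ _ => mul_eq_zero_of_right _ ?_
  obtain ⟨⟨i, ε⟩, rfl⟩ := (σ.trans (pairEquiv n)).surjective r
  refine Finset.prod_eq_zero (Finset.mem_univ i) ?_
  fin_cases ε
  · exact hrow _
  · exact hcol _

/-- The `2 n` nodes `q y₁, y₁, …, q yₙ, yₙ` at which the skew inner product evaluates
polynomials. -/
def qNodes (q : ℝ) (y : Fin n → ℝ) (k : Fin (2 * n)) : ℝ :=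
  ![q * y ((pairEquiv n).symm k).1, y ((pairEquiv n).symm k).1] ((pairEquiv n).symm k).2

theorem qNodes_pairEquiv_zero (q : ℝ) (y : Fin n → ℝ) (i : Fin n) :
    qNodes q y (pairEquiv n (i, 0)) = q * y i := by
  simp [qNodes]

theorem qNodes_pairEquiv_one (q : ℝ) (y : Fin n → ℝ) (i : Fin n) :
    qNodes q y (pairEquiv n (i, 1)) = y i := by
  simp [qNodes]

theorem sum_qNodes (q : ℝ) (y : Fin n → ℝ) : ∑ k, qNodes q y k = (1 + q) * ∑ i, y i := by
  simp only [← (pairEquiv n).sum_comp, Fintype.sum_prod_type, Fin.sum_univ_two,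
    qNodes_pairEquiv_zero, qNodes_pairEquiv_one, Finset.mul_sum, add_mul, one_mul, add_comm]

theorem prod_sub_qNodes (q : ℝ) (y : Fin n → ℝ) (x : ℝ) :
    ∏ k, (x - qNodes q y k) = ∏ i, ((x - y i) * (x - q * y i)) := by
  simp only [← (pairEquiv n).prod_comp, Fintype.prod_prod_type, Fin.prod_univ_two,
    qNodes_pairEquiv_zero, qNodes_pairEquiv_one, mul_comm]

theorem prod_prod_Ioi_sq {M : Type*} [CommMonoid M] (q : M) (n : ℕ) :
    ∏ i : Fin n, ∏ _j ∈ Finset.Ioi i, q ^ 2 = q ^ (n * (n - 1)) := by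
  simp only [Finset.prod_const, Fin.card_Ioi, ← pow_mul, Finset.prod_pow_eq_pow_sum]
  rw [← Finset.mul_sum, Fin.sum_univ_eq_sum_range (fun i => n - 1 - i),
    Finset.sum_range_reflect (fun i => i), mul_comm, Finset.sum_range_id_mul_two]

theorem det_vandermonde_qNodes {q : ℝ} (hq : q ≠ 0) (y : Fin n → ℝ) :
    (Matrix.vandermonde (qNodes q y)).det =
      q ^ (n * (n - 1)) * (qDelta4 q y * ∏ i, ((1 - q) * y i)) := by
  rw [Matrix.det_vandermonde, prod_prod_Ioi_pairEquiv, ← prod_prod_Ioi_sq, mul_comm, ← mul_assoc]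
  refine congrArg₂ (· * ·) ?_ (Finset.prod_congr rfl fun i _ => ?_)
  · simp only [qDelta4, ← Finset.prod_mul_distrib]
    refine Finset.prod_congr rfl fun i _ => Finset.prod_congr rfl fun j _ => ?_
    simp only [Fin.prod_univ_two, qNodes_pairEquiv_zero, qNodes_pairEquiv_one]
    field_simp
    ring
  · rw [qNodes_pairEquiv_zero, qNodes_pairEquiv_one]
    ring

end Pairing

section PolynomialsAtNodes

variable {R : Type*} [CommRing R] {m : ℕ}

theorem monic_and_natDegree_eq_iff [Nontrivial R] {p : R[X]} :
    p.Monic ∧ p.natDegree = m ↔ p - X ^ m ∈ degreeLT R m := by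
  rw [mem_degreeLT]
  constructor
  · rintro ⟨hp, rfl⟩
    rw [← degree_eq_natDegree hp.ne_zero]
    exact degree_sub_lt_left (by rw [degree_X_pow, degree_eq_natDegree hp.ne_zero]) hp.ne_zero
      (by rw [hp.leadingCoeff, leadingCoeff_X_pow])
  · intro h
    have hX : (p - X ^ m).degree < (X ^ m : R[X]).degree := by rwa [degree_X_pow]
    rw [← sub_add_cancel p (X ^ m)]
    refine ⟨(monic_X_pow m).add_of_right hX, ?_⟩
    rw [natDegree_add_eq_right_of_degree_lt hX, natDegree_X_pow]

theorem sub_X_pow_add_nextCoeff_mem_degreeLT {p : R[X]} (hp : p.Monic) (hm : p.natDegree = m + 1) :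
    p - (X ^ (m + 1) + C p.nextCoeff * X ^ m) ∈ degreeLT R m := by
  rw [mem_degreeLT, degree_lt_iff_coeff_zero]
  intro k hk
  have coeff_top : p.coeff (m + 1) = 1 := hm ▸ hp.coeff_natDegree
  have coeff_next : p.nextCoeff = p.coeff m := by
    rw [nextCoeff_of_natDegree_pos (by omega), hm, Nat.add_sub_cancel]
  rw [coeff_sub, coeff_add, coeff_C_mul, coeff_X_pow, coeff_X_pow, coeff_next]
  rcases lt_trichotomy k (m + 1) with h | rfl | h
  · obtain rfl : k = m := by omega
    simp
  · simp [coeff_top]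
  · simp [coeff_eq_zero_of_natDegree_lt (hm.trans_lt h), h.ne', (Nat.lt_of_succ_lt h).ne']

theorem monic_and_natDegree_eq_succ_iff [Nontrivial R] {p : R[X]} :
    p.Monic ∧ p.natDegree = m + 1 ↔
      ∃ c, p - (X ^ (m + 1) + C c * X ^ m) ∈ degreeLT R m := by
  refine ⟨fun ⟨hp, hm⟩ => ⟨_, sub_X_pow_add_nextCoeff_mem_degreeLT hp hm⟩, fun ⟨c, hc⟩ => ?_⟩
  rw [monic_and_natDegree_eq_iff, ← sub_add_cancel (p - X ^ (m + 1)) (C c * X ^ m), sub_sub]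
  exact add_mem (degreeLT_mono m.le_succ hc)
    (mem_degreeLT.2 <| (degree_C_mul_X_pow_le m c).trans_lt (by exact_mod_cast m.lt_succ_self))

theorem eval_prod_X_sub_C_self (v : Fin m → R) (k : Fin m) :
    (∏ k, (X - C (v k))).eval (v k) = 0 := by
  rw [eval_prod]
  exact Finset.prod_eq_zero (Finset.mem_univ k) (by simp)

theorem prod_X_sub_C_sub_X_pow_mem_degreeLT (v : Fin m → R) :
    ∏ k, (X - C (v k)) - X ^ m ∈ degreeLT R m := by
  nontriviality R
  refine monic_and_natDegree_eq_iff.1 ⟨monic_prod_X_sub_C _ _, ?_⟩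
  rw [natDegree_finsetProd_X_sub_C_eq_card, Finset.card_univ, Fintype.card_fin]

theorem X_add_C_mul_prod_X_sub_C_sub_mem_degreeLT (v : Fin m → R) (c : R) :
    (X + C (∑ k, v k + c)) * ∏ k, (X - C (v k)) - (X ^ (m + 1) + C c * X ^ m) ∈
      degreeLT R m := by
  nontriviality R
  set v' : Fin (m + 1) → R := Fin.cons (-(∑ k, v k + c)) v with hv'
  have prod_eq : (X + C (∑ k, v k + c)) * ∏ k, (X - C (v k)) = ∏ k, (X - C (v' k)) := by
    simp [hv', Fin.prod_univ_succ, sub_eq_add_neg, add_comm]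
  have nextCoeff_eq : (∏ k, (X - C (v' k))).nextCoeff = c := by
    simp [hv', prod_X_sub_C_nextCoeff, Fin.sum_univ_succ]
  rw [prod_eq]
  simpa only [nextCoeff_eq] using
    sub_X_pow_add_nextCoeff_mem_degreeLT (monic_prod_X_sub_C v' Finset.univ) <| by
      rw [natDegree_finsetProd_X_sub_C_eq_card, Finset.card_univ, Fintype.card_fin]

theorem eval_mul_det_vandermonde {r : R[X]} (hr : r ∈ degreeLT R m) (v : Fin m → R) (x : R) :
    r.eval x * (Matrix.vandermonde v).det =
      ∑ j : Fin m, x ^ (j : ℕ) *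
        ((Matrix.vandermonde v).updateCol j fun k => r.eval (v k)).det := by
  set c := degreeLTEquiv R m ⟨r, hr⟩
  have eval_eq_sum (z : R) : r.eval z = ∑ j, c j • z ^ (j : ℕ) := eval_eq_sum_degreeLTEquiv hr z
  have det_eq (j : Fin m) :
      ((Matrix.vandermonde v).updateCol j fun k => r.eval (v k)).det =
        c j • (Matrix.vandermonde v).det := by
    simp only [eval_eq_sum]
    exact Matrix.det_updateCol_sum (Matrix.vandermonde v) j c
  simp only [det_eq, eval_eq_sum x, Finset.sum_mul, smul_eq_mul]
  exact Finset.sum_congr rfl fun j _ => by ring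

theorem vandermonde_eq_of_eval (v : Fin m → R) :
    Matrix.vandermonde v = Matrix.of fun k (j : Fin m) => (X ^ (j : ℕ) : R[X]).eval (v k) := by
  ext k j
  simp only [Matrix.vandermonde_apply, Matrix.of_apply, eval_pow, eval_X]

theorem updateCol_vandermonde_eq_of_eval (v : Fin m → R) (j : Fin m) (p : R[X]) :
    (Matrix.vandermonde v).updateCol j (fun k => p.eval (v k)) =
      Matrix.of fun k i => (Function.update (fun i : Fin m => X ^ (i : ℕ)) j p i).eval (v k) := by
  ext k i
  rcases eq_or_ne i j with rfl | hi
  · simp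
  · simp [hi]

end PolynomialsAtNodes

section DeBruijn

variable {q : ℝ} {a b : EReal} {ω : ℝ → ℝ} {n : ℕ}

theorem sum_sign_mul_prod_qCasoratian (q : ℝ) (f : Fin (2 * n) → ℝ[X]) (y : Fin n → ℝ) :
    ∑ σ : Equiv.Perm (Fin n × Fin 2), (Equiv.Perm.sign σ : ℝ) * ∏ i,
      qCasoratian q (f (pairEquiv n (σ (i, 0)))) (f (pairEquiv n (σ (i, 1)))) (y i) =
        2 ^ n * (Matrix.of fun k j => (f j).eval (qNodes q y k)).det := by
  rw [← Matrix.det_transpose, ← Matrix.det_submatrix_equiv_self (pairEquiv n)]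
  convert sum_sign_mul_prod_det_submatrix _ using 3 with σ
  · refine Finset.prod_congr rfl fun i _ => ?_
    rw [Matrix.det_fin_two]
    simp only [Matrix.submatrix_apply, Matrix.transpose_apply, Matrix.of_apply,
      qNodes_pairEquiv_zero, qNodes_pairEquiv_one, qCasoratian]
  · simp only [Fintype.card_fin, Nat.factorial_two, Nat.cast_ofNat]
  · rw [Fintype.card_fin]

theorem det_eval_qNodes_mul_prod_qSkewWeight (q : ℝ) (ω : ℝ → ℝ) (f : Fin (2 * n) → ℝ[X])
    (y : Fin n → ℝ) :
    (Matrix.of fun k j => (f j).eval (qNodes q y k)).det * ∏ i, qSkewWeight q ω (y i) =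
      (2 ^ n)⁻¹ * ∑ σ : Equiv.Perm (Fin n × Fin 2), (Equiv.Perm.sign σ : ℝ) * ∏ i,
        qCasoratian q (f (pairEquiv n (σ (i, 0)))) (f (pairEquiv n (σ (i, 1)))) (y i) *
          qSkewWeight q ω (y i) := by
  simp only [Finset.prod_mul_distrib, ← mul_assoc, ← Finset.sum_mul]
  simp only [mul_assoc, sum_sign_mul_prod_qCasoratian]
  field_simp

theorem HasJacksonMoments.jacksonIntegrablePi_prod_qCasoratian_mul
    (hω : HasJacksonMoments q a b ω) (f g : Fin n → ℝ[X]) :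
    JacksonIntegrablePi q a b n fun y =>
      ∏ i, qCasoratian q (f i) (g i) (y i) * qSkewWeight q ω (y i) :=
  jacksonIntegrablePi_prod fun i => hω.jacksonIntegrable_qCasoratian_mul (f i) (g i)

theorem HasJacksonMoments.jacksonIntegrablePi_det_eval_qNodes (hω : HasJacksonMoments q a b ω)
    (f : Fin (2 * n) → ℝ[X]) :
    JacksonIntegrablePi q a b n fun y =>
      (Matrix.of fun k j => (f j).eval (qNodes q y k)).det * ∏ i, qSkewWeight q ω (y i) := by
  simp only [det_eval_qNodes_mul_prod_qSkewWeight]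
  exact .const_mul (.sum fun σ _ =>
    .const_mul (hω.jacksonIntegrablePi_prod_qCasoratian_mul _ _) _) _

theorem HasJacksonMoments.jacksonIntegralPi_det_eval_qNodes (hω : HasJacksonMoments q a b ω)
    (f : Fin (2 * n) → ℝ[X]) :
    jacksonIntegralPi q a b n (fun y =>
      (Matrix.of fun k j => (f j).eval (qNodes q y k)).det * ∏ i, qSkewWeight q ω (y i)) =
      n.factorial * pfaffian (Matrix.of fun i j => qSkewInner q a b ω (f i) (f j)) := by
  simp only [det_eval_qNodes_mul_prod_qSkewWeight]
  rw [jacksonIntegralPi_const_mul, jacksonIntegralPi_sum fun σ _ =>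
    (hω.jacksonIntegrablePi_prod_qCasoratian_mul _ _).const_mul _, pfaffian_eq_sum_perm_pairs]
  simp only [jacksonIntegralPi_const_mul, Matrix.of_apply, qSkewInner_eq_jacksonIntegral,
    ← jacksonIntegralPi_prod]
  field_simp [n.factorial_ne_zero]

theorem HasJacksonMoments.jacksonIntegralPi_det_vandermonde (hω : HasJacksonMoments q a b ω)
    (n : ℕ) : jacksonIntegralPi q a b n (fun y =>
      (Matrix.vandermonde (qNodes q y)).det * ∏ i, qSkewWeight q ω (y i)) =
      n.factorial * pfaffian (qMomentMatrix q a b ω n) := by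
  simp only [vandermonde_eq_of_eval]
  exact hω.jacksonIntegralPi_det_eval_qNodes fun j => X ^ (j : ℕ)

theorem det_vandermonde_qNodes_mul_prod_qSkewWeight (hq0 : q ≠ 0) (hq1 : q ≠ 1) (ω : ℝ → ℝ)
    {y : Fin n → ℝ} (hy : ∀ i, y i ≠ 0) :
    (Matrix.vandermonde (qNodes q y)).det * ∏ i, qSkewWeight q ω (y i) =
      q ^ (n * (n - 1)) * (qDelta4 q y * ∏ i, ω (y i)) := by
  have weight_eq (i : Fin n) : (1 - q) * y i * qSkewWeight q ω (y i) = ω (y i) :=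
    mul_div_cancel₀ _ <| mul_ne_zero (sub_ne_zero.2 hq1.symm) (hy i)
  simp only [det_vandermonde_qNodes hq0, mul_assoc, ← Finset.prod_mul_distrib]
  simp only [← mul_assoc, weight_eq]

theorem factorial_mul_qTau (q : ℝ) (a b : EReal) (ω : ℝ → ℝ) (n : ℕ) :
    n.factorial * qTau q a b ω n =
      jacksonIntegralPi q a b n fun x => qDelta4 q x * ∏ i, ω (x i) := by
  rw [qTau, ← mul_assoc, mul_one_div_cancel (Nat.cast_ne_zero.2 n.factorial_ne_zero), one_mul]

theorem pfaffian_qMomentMatrix (hq0 : q ≠ 0) (hq1 : q ≠ 1) (hω : HasJacksonMoments q a b ω)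
    (n : ℕ) :
    pfaffian (qMomentMatrix q a b ω n) = q ^ (n * (n - 1)) * qTau q a b ω n := by
  refine mul_left_cancel₀ (Nat.cast_ne_zero.2 n.factorial_ne_zero : (n.factorial : ℝ) ≠ 0) ?_
  rw [← hω.jacksonIntegralPi_det_vandermonde, mul_left_comm, factorial_mul_qTau,
    ← jacksonIntegralPi_const_mul]
  exact jacksonIntegralPi_congr_of_ne_zero fun y hy =>
    det_vandermonde_qNodes_mul_prod_qSkewWeight hq0 hq1 ω hy

end DeBruijn

section Orthogonal

variable {q : ℝ} {a b : EReal} {ω : ℝ → ℝ} {n : ℕ}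

-- Replacing a monomial by a polynomial orthogonal to all of them annihilates a row and a column
-- of the moment matrix.
theorem jacksonIntegralPi_det_updateCol_eq_zero (hω : HasJacksonMoments q a b ω) {p : ℝ[X]}
    (hp : p ∈ (qSkewForm hω).orthogonal (degreeLT ℝ (2 * n))) (j : Fin (2 * n)) :
    jacksonIntegralPi q a b n (fun y =>
      ((Matrix.vandermonde (qNodes q y)).updateCol j fun k => p.eval (qNodes q y k)).det *
        ∏ i, qSkewWeight q ω (y i)) = 0 := by
  simp only [updateCol_vandermonde_eq_of_eval, hω.jacksonIntegralPi_det_eval_qNodes]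
  set f : Fin (2 * n) → ℝ[X] := Function.update (fun i => X ^ (i : ℕ)) j p with hf
  have col_zero (k : Fin (2 * n)) : qSkewForm hω (f k) (f j) = 0 := by
    rw [hf, Function.update_self]
    rcases eq_or_ne k j with rfl | hk
    · rw [Function.update_self, isAlt_qSkewForm hω p]
    · rw [Function.update_of_ne hk]
      exact hp _ (mem_degreeLT.2 ((degree_X_pow_le _).trans_lt (by exact_mod_cast k.2)))
  exact mul_eq_zero_of_right _ <| pfaffian_eq_zero_of_row_col
    (fun k => (isAlt_qSkewForm hω).isRefl _ _ (col_zero k)) col_zero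

theorem eval_mul_pfaffian_eq_jacksonIntegralPi (hω : HasJacksonMoments q a b ω) {p : ℝ[X]}
    (hp : p ∈ (qSkewForm hω).orthogonal (degreeLT ℝ (2 * n))) {G : (Fin n → ℝ) → ℝ[X]}
    (hG : ∀ y k, (G y).eval (qNodes q y k) = 0) (hpG : ∀ y, p - G y ∈ degreeLT ℝ (2 * n))
    (x : ℝ) :
    p.eval x * (n.factorial * pfaffian (qMomentMatrix q a b ω n)) =
      jacksonIntegralPi q a b n fun y => (G y).eval x *
        ((Matrix.vandermonde (qNodes q y)).det * ∏ i, qSkewWeight q ω (y i)) := by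
  set V : (Fin n → ℝ) → ℝ := fun y =>
    (Matrix.vandermonde (qNodes q y)).det * ∏ i, qSkewWeight q ω (y i)
  set V' : Fin (2 * n) → (Fin n → ℝ) → ℝ := fun j y =>
    ((Matrix.vandermonde (qNodes q y)).updateCol j fun k => p.eval (qNodes q y k)).det *
      ∏ i, qSkewWeight q ω (y i) with hV'
  have hV : JacksonIntegrablePi q a b n fun y => p.eval x * V y := by
    simp only [V, vandermonde_eq_of_eval]
    exact (hω.jacksonIntegrablePi_det_eval_qNodes _).const_mul _
  have hxV' (j : Fin (2 * n)) : JacksonIntegrablePi q a b n fun y => -x ^ (j : ℕ) * V' j y := by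
    simp only [V', updateCol_vandermonde_eq_of_eval]
    exact (hω.jacksonIntegrablePi_det_eval_qNodes _).const_mul _
  have expand (y : Fin n → ℝ) :
      (G y).eval x * V y = p.eval x * V y + ∑ j : Fin (2 * n), -x ^ (j : ℕ) * V' j y := by
    have h := eval_mul_det_vandermonde (hpG y) (qNodes q y) x
    simp only [eval_sub, hG, sub_zero] at h
    simp only [V, V', neg_mul, Finset.sum_neg_distrib, ← mul_assoc, ← Finset.sum_mul, ← h]
    ring
  rw [funext expand, jacksonIntegralPi_add hV (.sum fun j _ => hxV' j),
    jacksonIntegralPi_sum fun j _ => hxV' j]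
  simp only [jacksonIntegralPi_const_mul, hV', jacksonIntegralPi_det_updateCol_eq_zero hω hp,
    mul_zero, Finset.sum_const_zero, add_zero]
  rw [← hω.jacksonIntegralPi_det_vandermonde]

theorem eval_eq_jacksonIntegralPi_of_mem_orthogonal (hq0 : q ≠ 0) (hq1 : q ≠ 1)
    (hω : HasJacksonMoments q a b ω) (hτ : qTau q a b ω n ≠ 0) {p : ℝ[X]}
    (hp : p ∈ (qSkewForm hω).orthogonal (degreeLT ℝ (2 * n))) {G : (Fin n → ℝ) → ℝ[X]}
    (hG : ∀ y k, (G y).eval (qNodes q y k) = 0) (hpG : ∀ y, p - G y ∈ degreeLT ℝ (2 * n))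
    (x : ℝ) :
    p.eval x = 1 / (n.factorial * qTau q a b ω n) *
      jacksonIntegralPi q a b n fun y => qDelta4 q y * ((G y).eval x * ∏ i, ω (y i)) := by
  have h := eval_mul_pfaffian_eq_jacksonIntegralPi hω hp hG hpG x
  rw [pfaffian_qMomentMatrix hq0 hq1 hω, jacksonIntegralPi_congr_of_ne_zero (G := fun y =>
    q ^ (n * (n - 1)) * (qDelta4 q y * ((G y).eval x * ∏ i, ω (y i)))) fun y hy => by
      rw [det_vandermonde_qNodes_mul_prod_qSkewWeight hq0 hq1 ω hy]; ring,
    jacksonIntegralPi_const_mul, mul_left_comm (n.factorial : ℝ), mul_left_comm] at h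
  rw [one_div, ← mul_left_cancel₀ (pow_ne_zero _ hq0) h, mul_comm, mul_inv_cancel_right₀
    (mul_ne_zero (Nat.cast_ne_zero.2 n.factorial_ne_zero) hτ)]

theorem isCompl_degreeLT_orthogonal (hq0 : q ≠ 0) (hq1 : q ≠ 1) (hω : HasJacksonMoments q a b ω)
    (hτ : qTau q a b ω n ≠ 0) :
    IsCompl (degreeLT ℝ (2 * n)) ((qSkewForm hω).orthogonal (degreeLT ℝ (2 * n))) := by
  have : FiniteDimensional ℝ (degreeLT ℝ (2 * n)) := .of_basis (degreeLT.basis ℝ (2 * n))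
  refine isCompl_orthogonal_of_disjoint (isAlt_qSkewForm hω).isRefl <|
    Submodule.disjoint_def.2 fun p hp hp' => Polynomial.funext fun x => ?_
  simpa only [eval_zero, zero_mul, mul_zero, jacksonIntegralPi_zero] using
    eval_eq_jacksonIntegralPi_of_mem_orthogonal hq0 hq1 hω hτ hp' (G := fun _ => 0)
      (fun _ _ => eval_zero) (fun _ => by rwa [sub_zero]) x

theorem sub_mem_degreeLT_and_mem_orthogonal_iff (hq0 : q ≠ 0) (hq1 : q ≠ 1)
    (hω : HasJacksonMoments q a b ω) (hτ : qTau q a b ω n ≠ 0) {p g : ℝ[X]}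
    {G : (Fin n → ℝ) → ℝ[X]} (hG : ∀ y k, (G y).eval (qNodes q y k) = 0)
    (hGg : ∀ y, G y - g ∈ degreeLT ℝ (2 * n)) :
    p - g ∈ degreeLT ℝ (2 * n) ∧ p ∈ (qSkewForm hω).orthogonal (degreeLT ℝ (2 * n)) ↔
      ∀ x, p.eval x = 1 / (n.factorial * qTau q a b ω n) *
        jacksonIntegralPi q a b n fun y => qDelta4 q y * ((G y).eval x * ∏ i, ω (y i)) := by
  have eval_eq {r : ℝ[X]} (hrg : r - g ∈ degreeLT ℝ (2 * n))
      (hr : r ∈ (qSkewForm hω).orthogonal (degreeLT ℝ (2 * n))) :=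
    eval_eq_jacksonIntegralPi_of_mem_orthogonal hq0 hq1 hω hτ hr hG fun y => by
      simpa only [sub_sub_sub_cancel_right] using sub_mem hrg (hGg y)
  refine ⟨fun ⟨hpg, hp⟩ => eval_eq hpg hp, fun hp => ?_⟩
  obtain ⟨r, s, hr, hs, rfl⟩ := Submodule.codisjoint_iff_exists_add_eq.1
    (isCompl_degreeLT_orthogonal hq0 hq1 hω hτ).codisjoint g
  have hsg : s - (r + s) ∈ degreeLT ℝ (2 * n) := by simpa using hr
  obtain rfl : p = s := Polynomial.funext fun x => (hp x).trans (eval_eq hsg hs x).symm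
  exact ⟨hsg, hs⟩

theorem monic_even_and_mem_orthogonal_iff (hq0 : q ≠ 0) (hq1 : q ≠ 1)
    (hω : HasJacksonMoments q a b ω) (hτ : qTau q a b ω n ≠ 0) {p : ℝ[X]} :
    (p.Monic ∧ p.natDegree = 2 * n) ∧ p ∈ (qSkewForm hω).orthogonal (degreeLT ℝ (2 * n)) ↔
      ∀ x, p.eval x = 1 / (n.factorial * qTau q a b ω n) *
        jacksonIntegralPi q a b n fun y =>
          qDelta4 q y * ∏ i, ((x - y i) * (x - q * y i) * ω (y i)) := by
  rw [monic_and_natDegree_eq_iff, sub_mem_degreeLT_and_mem_orthogonal_iff hq0 hq1 hω hτ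
    (G := fun y => ∏ k, (X - C (qNodes q y k)))
    (fun y k => eval_prod_X_sub_C_self _ _) fun y => prod_X_sub_C_sub_X_pow_mem_degreeLT _]
  simp only [eval_prod, eval_sub, eval_X, eval_C, prod_sub_qNodes, Finset.prod_mul_distrib]

theorem monic_odd_and_mem_orthogonal_iff (hq0 : q ≠ 0) (hq1 : q ≠ 1)
    (hω : HasJacksonMoments q a b ω) (hτ : qTau q a b ω n ≠ 0) {p : ℝ[X]} :
    (p.Monic ∧ p.natDegree = 2 * n + 1) ∧
        p ∈ (qSkewForm hω).orthogonal (degreeLT ℝ (2 * n)) ↔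
      ∃ c, ∀ x, p.eval x = 1 / (n.factorial * qTau q a b ω n) *
        jacksonIntegralPi q a b n fun y => qDelta4 q y * (x + (1 + q) * (∑ i, y i) + c) *
          ∏ i, ((x - y i) * (x - q * y i) * ω (y i)) := by
  rw [monic_and_natDegree_eq_succ_iff, ← exists_and_right]
  refine exists_congr fun c => ?_
  rw [sub_mem_degreeLT_and_mem_orthogonal_iff hq0 hq1 hω hτ
    (G := fun y => (X + C (∑ k, qNodes q y k + c)) * ∏ k, (X - C (qNodes q y k)))
    (fun y k => by rw [eval_mul, eval_prod_X_sub_C_self, mul_zero])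
    fun y => X_add_C_mul_prod_X_sub_C_sub_mem_degreeLT _ c]
  simp only [eval_mul, eval_add, eval_prod, eval_sub, eval_X, eval_C, sum_qNodes, prod_sub_qNodes,
    Finset.prod_mul_distrib, mul_assoc, add_assoc]

theorem mem_orthogonal_degreeLT_iff (hω : HasJacksonMoments q a b ω) {Q : ℕ → ℝ[X]}
    (hQ : ∀ i, (Q i).Monic ∧ (Q i).natDegree = i) {m : ℕ} {p : ℝ[X]} :
    p ∈ (qSkewForm hω).orthogonal (degreeLT ℝ m) ↔ ∀ i < m, qSkewInner q a b ω (Q i) p = 0 := by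
  have degree_eq (i : ℕ) : (Q i).degree = i := by
    rw [degree_eq_natDegree (hQ i).1.ne_zero, (hQ i).2]
  have span_eq : Submodule.span ℝ (Q '' Set.Iio m) = degreeLT ℝ m :=
    Polynomial.Sequence.span_degreeLT ⟨Q, degree_eq⟩ fun i _ => (hQ i).1.leadingCoeff ▸ isUnit_one
  rw [← span_eq]
  refine ⟨fun hp i hi => hp _ (Submodule.subset_span ⟨i, hi, rfl⟩), fun hp => ?_⟩
  have span_le : Submodule.span ℝ (Q '' Set.Iio m) ≤ ((qSkewForm hω).flip p).ker :=
    Submodule.span_le.2 <| Set.forall_mem_image.2 fun i hi => hp i hi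
  exact fun r hr => span_le hr

theorem isQSkewOrthogonal_iff (hω : HasJacksonMoments q a b ω) {Q : ℕ → ℝ[X]} :
    IsQSkewOrthogonal q a b ω Q ↔
      (∀ n, ((Q (2 * n)).Monic ∧ (Q (2 * n)).natDegree = 2 * n) ∧
        Q (2 * n) ∈ (qSkewForm hω).orthogonal (degreeLT ℝ (2 * n))) ∧
      ∀ n, ((Q (2 * n + 1)).Monic ∧ (Q (2 * n + 1)).natDegree = 2 * n + 1) ∧
        Q (2 * n + 1) ∈ (qSkewForm hω).orthogonal (degreeLT ℝ (2 * n)) := by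
  constructor
  · rintro ⟨hQ, u, hu⟩
    simp only [hQ, mem_orthogonal_degreeLT_iff hω hQ, and_self, true_and]
    refine ⟨fun n i hi => ?_, fun n i hi => ?_⟩ <;>
      obtain ⟨m, rfl | rfl⟩ := Nat.even_or_odd' i
    · exact (hu m n).2.2.1
    · rw [(hu m n).2.1, if_neg (by omega), neg_zero]
    · rw [(hu n m).1, if_neg (by omega)]
    · exact (hu m n).2.2.2
  · rintro ⟨hEven, hOdd⟩
    have hQ (i : ℕ) : (Q i).Monic ∧ (Q i).natDegree = i := by
      obtain ⟨n, rfl | rfl⟩ := Nat.even_or_odd' i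
      exacts [(hEven n).1, (hOdd n).1]
    have eq_zero_of_lt {i j : ℕ} (h : i / 2 < j / 2) : qSkewInner q a b ω (Q i) (Q j) = 0 := by
      obtain ⟨n, rfl | rfl⟩ := Nat.even_or_odd' j
      · exact (mem_orthogonal_degreeLT_iff hω hQ).1 (hEven n).2 i (by omega)
      · exact (mem_orthogonal_degreeLT_iff hω hQ).1 (hOdd n).2 i (by omega)
    have eq_zero_of_ne {i j : ℕ} (h : i / 2 ≠ j / 2) : qSkewInner q a b ω (Q i) (Q j) = 0 :=
      h.lt_or_gt.elim eq_zero_of_lt fun h => (isAlt_qSkewForm hω).isRefl _ _ (eq_zero_of_lt h)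
    refine ⟨hQ, fun n => qSkewInner q a b ω (Q (2 * n)) (Q (2 * n + 1)), fun m n => ?_⟩
    rcases eq_or_ne n m with rfl | h
    · simp only [if_true, qSkewInner_neg, qSkewInner_self, and_self]
    · rw [if_neg h, neg_zero]
      refine ⟨?_, ?_, ?_, ?_⟩ <;> exact eq_zero_of_ne (by omega)

end Orthogonal

theorem proposition4p2_general (q : ℝ) (hq0 : q ≠ 0) (hq1 : q ≠ 1) (a b : EReal) (ω : ℝ → ℝ)
    (hω : HasJacksonMoments q a b ω) (hτ : ∀ n, qTau q a b ω n ≠ 0) :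
    (∀ n : ℕ, pfaffian (qMomentMatrix q a b ω n) = q ^ (n * (n - 1)) * qTau q a b ω n) ∧
    ∀ Q : ℕ → Polynomial ℝ, IsQSkewOrthogonal q a b ω Q ↔
      (∀ (n : ℕ) (x : ℝ), (Q (2 * n)).eval x =
        1 / ((n.factorial : ℝ) * qTau q a b ω n) *
          jacksonIntegralPi q a b n fun y =>
            qDelta4 q y * ∏ i, ((x - y i) * (x - q * y i) * ω (y i))) ∧
      ∃ c : ℕ → ℝ, ∀ (n : ℕ) (x : ℝ), (Q (2 * n + 1)).eval x =
        1 / ((n.factorial : ℝ) * qTau q a b ω n) *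
          jacksonIntegralPi q a b n fun y =>
            qDelta4 q y * (x + (1 + q) * (∑ i, y i) + c n) *
              ∏ i, ((x - y i) * (x - q * y i) * ω (y i)) := by
  refine ⟨pfaffian_qMomentMatrix hq0 hq1 hω, fun Q => ?_⟩
  rw [isQSkewOrthogonal_iff hω]
  refine and_congr (forall_congr' fun n => monic_even_and_mem_orthogonal_iff hq0 hq1 hω (hτ n)) <|
    (forall_congr' fun n => monic_odd_and_mem_orthogonal_iff hq0 hq1 hω (hτ n)).trans ?_
  exact Classical.skolem

theorem proposition4p2 (q : ℝ) (hq0 : 0 < q) (hq1 : q < 1) (a b : EReal) (ω : ℝ → ℝ)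
    (hω : HasJacksonMoments q a b ω) (hτ : ∀ n, qTau q a b ω n ≠ 0) :
    (∀ n : ℕ, pfaffian (qMomentMatrix q a b ω n) = q ^ (n * (n - 1)) * qTau q a b ω n) ∧
    ∀ Q : ℕ → Polynomial ℝ, IsQSkewOrthogonal q a b ω Q ↔
      (∀ (n : ℕ) (x : ℝ), (Q (2 * n)).eval x =
        1 / ((n.factorial : ℝ) * qTau q a b ω n) *
          jacksonIntegralPi q a b n fun y =>
            qDelta4 q y * ∏ i, ((x - y i) * (x - q * y i) * ω (y i))) ∧
      ∃ c : ℕ → ℝ, ∀ (n : ℕ) (x : ℝ), (Q (2 * n + 1)).eval x =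
        1 / ((n.factorial : ℝ) * qTau q a b ω n) *
          jacksonIntegralPi q a b n fun y =>
            qDelta4 q y * (x + (1 + q) * (∑ i, y i) + c n) *
              ∏ i, ((x - y i) * (x - q * y i) * ω (y i)) :=
  proposition4p2_general q hq0.ne' hq1.ne a b ω hω hτ
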